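/- Let $(X,\mu)$ be a standard probability space (atoms allowed) and let $T$ be an ergodic automorphism of $(X,\mu)$. A semimetric is a function $\rho\colon X\times X\to[0,\infty)$ with $\rho(x,x)=0$, $\rho(x,y)=\rho(y,x)$ and $\rho(x,z)\le\rho(x,y)+\rho(y,z)$ for all $x,y,z\in X$. It is - measurable if it is measurable on $(X^2,\mu^2)$ as a function of two variables; - admissible if it is measurable and there is a subset $X_1\subset X$ of full measure on which $\rho$ is separable; - summable if $\int_{X^2}\rho\,d\mu^2<\infty$; - generating if there is a measurable set $X'\subset X$ of full measure such that for any two distinct $x,y\in X'$ there is $k\in\mathbb Z$ with $\rho(T^kx,T^ky)>0$. For $\varepsilon>0$ let $\mathbb H_\varepsilon(X,\mu,\rho)=\log_2 k$, where $k\ge 1$ is the least natural number for which $X$ can be partitioned into disjoint measurable subsets $X_0,X_1,\dots,X_k$ such that $\mu(X_0)<\varepsilon$ and, for $j=1,\dots,k$, the $\rho$-diameter of $X_j$ is less than $\varepsilon$ (some of the $X_j$ may be empty); put $\mathbb H_\varepsilon(X,\mu,\rho)=+\infty$ if no such $k$ exists. For $n\ge 1$ let $$T^n_{av}\rho(x,y)=\frac1n\sum_{k=0}^{n-1}\rho(T^kx,T^ky).$$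 Let $\mathcal H(X,\mu,T,\rho)$ be the class of scaling sequences for $\rho$, that is, of all sequences $\{h_n\}$ of positive numbers such that $$\limsup_{n\to\infty}\frac{\mathbb H_\varepsilon(X,\mu,T^n_{av}\rho)}{h_n}<+\infty\quad\text{for every }\varepsilon>0,$$ $$\liminf_{n\to\infty}\frac{\mathbb H_\varepsilon(X,\mu,T^n_{av}\rho)}{h_n}>0\quad\text{for all sufficiently small }\varepsilon>0.$$ **Theorem.** If $\rho$ and $\tilde\rho$ are two summable admissible generating semimetrics on $(X,\mu)$, then $\mathcal H(X,\mu,T,\rho)=\mathcal H(X,\mu,T,\tilde\rho)$. -/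

import Mathlib

open MeasureTheory Filter Topology
open scoped ENNReal

noncomputable section

namespace ScalingEntropy

variable {X : Type*}

/-- A semimetric on `X`: finite, nonnegative, zero on the diagonal, symmetric, and satisfying the
triangle inequality; distinct points may be at distance zero. -/
structure IsSemimetric (ρ : X → X → ℝ) : Prop where
  nonneg : ∀ x y, 0 ≤ ρ x y
  self : ∀ x, ρ x x = 0
  symm : ∀ x y, ρ x y = ρ y x
  triangle : ∀ x y z, ρ x z ≤ ρ x y + ρ y z

/-- The `ρ`-diameter of a set, with values in `[0, ∞]`; the empty set has diameter zero. -/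
def diam (ρ : X → X → ℝ) (A : Set X) : ℝ≥0∞ :=
  ⨆ x ∈ A, ⨆ y ∈ A, ENNReal.ofReal (ρ x y)

/-- The set `A` is separable for `ρ`: some countable subset of `A` is `ρ`-dense in `A`. -/
def SeparableOn (ρ : X → X → ℝ) (A : Set X) : Prop :=
  ∃ D : Set X, D ⊆ A ∧ D.Countable ∧ ∀ x ∈ A, ∀ ε : ℝ, 0 < ε → ∃ d ∈ D, ρ x d < ε

variable [MeasurableSpace X]

/-- A semimetric that is measurable as a function of two variables with respect to the completion
of the product measure. -/
structure IsMeasurableSemimetric (μ : Measure X) (ρ : X → X → ℝ) : Prop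
    extends IsSemimetric ρ where
  measurable : NullMeasurable (Function.uncurry ρ) (μ.prod μ)

/-- An admissible semimetric: measurable, and separable on a subset of full measure. -/
structure IsAdmissible (μ : Measure X) (ρ : X → X → ℝ) : Prop
    extends IsMeasurableSemimetric μ ρ where
  separable : ∃ X₁ : Set X, μ X₁ᶜ = 0 ∧ SeparableOn ρ X₁

/-- `X` splits into disjoint sets `P 0, P 1, …, P k`, measurable with respect to the completion
of `μ`, such that `P 0` has measure less than `ε` and each of `P 1, …, P k` has
`ρ`-diameter less than `ε`. -/
def HasPartition (μ : Measure X) (ρ : X → X → ℝ) (ε : ℝ) (k : ℕ) : Prop :=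
  ∃ P : Fin (k + 1) → Set X,
    (∀ i, NullMeasurableSet (P i) μ) ∧
    Pairwise (fun i j => Disjoint (P i) (P j)) ∧
    (⋃ i, P i) = Set.univ ∧
    μ (P 0) < ENNReal.ofReal ε ∧
    ∀ j : Fin k, diam ρ (P j.succ) < ENNReal.ofReal ε

open Classical in
/-- The `ε`-entropy: `log₂ k` for the least positive natural number `k` admitting a partition as
in `HasPartition`, and `∞` if there is none. -/
def epsEntropy (μ : Measure X) (ρ : X → X → ℝ) (ε : ℝ) : ℝ≥0∞ :=
  if h : ∃ k : ℕ, 1 ≤ k ∧ HasPartition μ ρ ε k then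
    ENNReal.ofReal (Real.logb 2 (Nat.find h : ℝ))
  else ⊤

/-- The shift `T^k ρ (x, y) = ρ (T^k x, T^k y)`, `k ∈ ℤ`. -/
def shift (T : X ≃ᵐ X) (k : ℤ) (ρ : X → X → ℝ) : X → X → ℝ :=
  fun x y => ρ (((T.toEquiv : Equiv.Perm X) ^ k) x) (((T.toEquiv : Equiv.Perm X) ^ k) y)

/-- The average `(1/n) ∑_{k=0}^{n-1} T^k ρ`; the value at `n = 0` is immaterial. -/
def average (T : X ≃ᵐ X) (n : ℕ) (ρ : X → X → ℝ) : X → X → ℝ :=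
  fun x y => (1 / (n : ℝ)) * ∑ k ∈ Finset.range n, shift T (k : ℤ) ρ x y

/-- Two-sided generating semimetrics: the shifts by `k ∈ ℤ` separate the points of a measurable
set of full measure. -/
def IsGenerating (μ : Measure X) (T : X ≃ᵐ X) (ρ : X → X → ℝ) : Prop :=
  ∃ X' : Set X, NullMeasurableSet X' μ ∧ μ X'ᶜ = 0 ∧
    ∀ x ∈ X', ∀ y ∈ X', x ≠ y → ∃ k : ℤ, 0 < shift T k ρ x y

/-- Summability: the semimetric is integrable on `(X × X, μ × μ)`. -/
def IsSummable (μ : Measure X) (ρ : X → X → ℝ) : Prop :=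
  Integrable (Function.uncurry ρ) (μ.prod μ)

/-- The class of scaling sequences of a semimetric `ρ`: the sequences `h` of positive numbers
such that the upper limit of `H_ε(T^n_av ρ) / h_n` is finite for every `ε > 0` and its
lower limit is positive for all sufficiently small `ε > 0`. -/
def scalingSequences (μ : Measure X) (T : X ≃ᵐ X) (ρ : X → X → ℝ) : Set (ℕ → ℝ) :=
  {h | (∀ n, 0 < h n) ∧
    (∀ ε : ℝ, 0 < ε →
      limsup (fun n => epsEntropy μ (average T n ρ) ε / ENNReal.ofReal (h n)) atTop < ⊤) ∧
    (∃ ε₀ : ℝ, 0 < ε₀ ∧ ∀ ε : ℝ, 0 < ε → ε < ε₀ →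
      0 < liminf (fun n => epsEntropy μ (average T n ρ) ε / ENNReal.ofReal (h n)) atTop)}

end ScalingEntropy

end

/-! By symmetry it suffices to find, for each `ε`, a `δ` such that the `ε`-entropy of the averages
of `ρ'` is at most the `δ`-entropy of those of `ρ` for all large `n`.

The source is `exists_domination`: `ρ' x y ≤ C * ∑ j ∈ J, shift T j ρ x y + (u x + u y)` with `J`
finite and `∫ u` small. Since `ρ` generates, the `ρ`-distances from the orbit of a point to
countably many centres determine the point almost everywhere. Inner regularity and compactness then
let finitely many of these coordinates separate small `ρ'`-cells (`exists_separating_shifts`), and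
each coordinate is 1-Lipschitz for a shift of `ρ`.

Averaging over `n` steps, a shift by `j` changes the average of `ρ` only through at most `|j|` edge
terms, so the error has integral `O(1/n)` (`exists_average_domination`). Markov's inequality moves
the remaining additive error into the exceptional set (`HasPartition.of_le`). -/

namespace ScalingEntropy

/-! ### Separation by compactness -/

/-- Disjoint measurable cells are separated, up to a set of small measure, by finitely many
coordinates of an almost everywhere injective map. -/
theorem exists_separating_coordinates {X ι : Type*} [MeasurableSpace X] [StandardBorelSpace X]
    [Countable ι] (μ : Measure X) [IsFiniteMeasure μ] {F : X → ι → ℝ} (hF : Measurable F)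
    {Y : Set X} (hY : MeasurableSet Y) (hYμ : μ Yᶜ = 0) (hinj : Set.InjOn F Y)
    {A : ℕ → Set X} (hA : ∀ i, MeasurableSet (A i)) (hdisj : Pairwise (fun i j => Disjoint (A i) (A j)))
    (hcover : μ (⋃ i, A i)ᶜ = 0) {β : ℝ≥0∞} (hβ : β ≠ 0) :
    ∃ G : Set X, MeasurableSet G ∧ μ Gᶜ < β ∧ ∃ J : Finset ι, ∃ δ : ℝ, 0 < δ ∧
      ∀ x ∈ G, ∀ y ∈ G, (∃ i, x ∈ A i ∧ y ∈ A i) ∨ ∃ c ∈ J, δ ≤ |F x c - F y c| := by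
  classical
  obtain ⟨b, hb, hbsum⟩ := ENNReal.exists_pos_sum_of_countable' hβ ℕ
  -- Lusin–Souslin: injective images of Borel sets are Borel, so the pushforward measure
  -- approximates them from inside by compact sets.
  have himg : ∀ i, MeasurableSet (F '' (A i ∩ Y)) := fun i =>
    ((hA i).inter hY).image_of_measurable_injOn hF (hinj.mono Set.inter_subset_right)
  have hK : ∀ i, ∃ K, K ⊆ F '' (A i ∩ Y) ∧ IsCompact K ∧
      (μ.map F) (F '' (A i ∩ Y)) < (μ.map F) K + b i := fun i =>
    (himg i).exists_isCompact_lt_add (measure_ne_top _ _) (hb i).ne'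
  choose K hKsub hKc hKm using hK
  have hKmeas : ∀ i, MeasurableSet (K i) := fun i => (hKc i).measurableSet
  have hdiff : ∀ i, μ ((A i ∩ Y) \ F ⁻¹' K i) ≤ b i := by
    intro i
    have h1 : (A i ∩ Y) \ F ⁻¹' K i ⊆ F ⁻¹' (F '' (A i ∩ Y) \ K i) := by
      rintro x ⟨hx, hxK⟩
      exact ⟨⟨x, hx, rfl⟩, hxK⟩
    calc μ ((A i ∩ Y) \ F ⁻¹' K i) ≤ μ (F ⁻¹' (F '' (A i ∩ Y) \ K i)) := measure_mono h1
      _ = (μ.map F) (F '' (A i ∩ Y) \ K i) := by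
        rw [Measure.map_apply hF ((himg i).diff (hKmeas i))]
      _ = (μ.map F) (F '' (A i ∩ Y)) - (μ.map F) (K i) :=
        measure_sdiff (hKsub i) (hKmeas i).nullMeasurableSet (measure_ne_top _ _)
      _ ≤ b i := by
        rw [tsub_le_iff_left]; exact (hKm i).le
  let G : ℕ → Set X := fun m => Y ∩ ⋃ i ∈ Finset.range m, F ⁻¹' K i
  have hGmeas : ∀ m, MeasurableSet (G m) := fun m =>
    hY.inter (Finset.measurableSet_biUnion _ fun i _ => hF (hKmeas i))
  have hGanti : Antitone fun m => (G m)ᶜ := by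
    intro m n hmn
    refine Set.compl_subset_compl.2 (Set.inter_subset_inter_right _ ?_)
    exact Set.biUnion_subset_biUnion_left (Finset.range_subset_range.2 hmn)
  have hlim := tendsto_measure_iInter_atTop (μ := μ)
    (fun m => (hGmeas m).compl.nullMeasurableSet) hGanti ⟨0, measure_ne_top _ _⟩
  have hlt : μ (⋂ m, (G m)ᶜ) < β := by
    have hsub : (⋂ m, (G m)ᶜ) ⊆ (Yᶜ ∪ (⋃ i, A i)ᶜ) ∪ ⋃ i, (A i ∩ Y) \ F ⁻¹' K i := by
      intro x hx
      by_cases hxY : x ∈ Y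
      · by_cases hxA : x ∈ ⋃ i, A i
        · right
          obtain ⟨i, hi⟩ := Set.mem_iUnion.1 hxA
          refine Set.mem_iUnion.2 ⟨i, ⟨hi, hxY⟩, fun hxK => ?_⟩
          refine Set.mem_iInter.1 hx (i + 1) ⟨hxY, ?_⟩
          exact Set.mem_biUnion (Finset.mem_coe.2 (Finset.self_mem_range_succ i)) hxK
        · exact Or.inl (Or.inr hxA)
      · exact Or.inl (Or.inl hxY)
    calc μ (⋂ m, (G m)ᶜ)
        ≤ μ (Yᶜ ∪ (⋃ i, A i)ᶜ) + μ (⋃ i, (A i ∩ Y) \ F ⁻¹' K i) :=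
          (measure_mono hsub).trans (measure_union_le _ _)
      _ ≤ 0 + ∑' i, b i := by
          refine add_le_add ?_ ((measure_iUnion_le _).trans (ENNReal.tsum_le_tsum hdiff))
          exact (measure_union_null hYμ hcover).le
      _ < β := by rwa [zero_add]
  obtain ⟨m, hm⟩ := (hlim.eventually_lt_const hlt).exists
  refine ⟨G m, hGmeas m, hm, ?_⟩
  -- Pairs from different compacts form a compact set off the diagonal; a finite subcover by the
  -- sets `U c` below yields both `J` and `δ`.
  let Q : Set ((ι → ℝ) × (ι → ℝ)) :=
    ⋃ p ∈ (Finset.range m ×ˢ Finset.range m).filter (fun p => p.1 ≠ p.2), K p.1 ×ˢ K p.2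
  have hQ : IsCompact Q := Finset.isCompact_biUnion _ fun p _ => (hKc p.1).prod (hKc p.2)
  have hKdisj : ∀ i j, i ≠ j → Disjoint (K i) (K j) := by
    intro i j hij
    rw [Set.disjoint_left]
    intro a hai haj
    obtain ⟨x, hx, rfl⟩ := hKsub i hai
    obtain ⟨y, hy, hyx⟩ := hKsub j haj
    have : y = x := hinj hy.2 hx.2 hyx
    subst this
    exact Set.disjoint_left.1 (hdisj hij) hx.1 hy.1
  let U : ι × ℕ → Set ((ι → ℝ) × (ι → ℝ)) := fun c => {q | 1 / ((c.2 : ℝ) + 1) < |q.1 c.1 - q.2 c.1|}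
  have hU : ∀ c, IsOpen (U c) := fun c => isOpen_lt continuous_const (by fun_prop)
  have hQU : Q ⊆ ⋃ c, U c := by
    rintro ⟨p, q⟩ hpq
    simp only [Q, Set.mem_iUnion, Finset.mem_filter] at hpq
    obtain ⟨⟨i, j⟩, ⟨_, hij⟩, hp, hq⟩ := hpq
    have hne : p ≠ q := fun h => Set.disjoint_left.1 (hKdisj i j hij) hp (h ▸ hq)
    obtain ⟨c, hc⟩ := Function.ne_iff.1 hne
    obtain ⟨n, hn⟩ := exists_nat_one_div_lt (abs_pos.2 (sub_ne_zero.2 hc))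
    exact Set.mem_iUnion.2 ⟨(c, n), hn⟩
  obtain ⟨t, ht⟩ := hQ.elim_finite_subcover U hU hQU
  refine ⟨t.image Prod.fst, 1 / ((t.sup Prod.snd : ℕ) + 1 : ℝ), by positivity, ?_⟩
  rintro x ⟨hxY, hx⟩ y ⟨hyY, hy⟩
  simp only [Set.mem_iUnion, Finset.mem_range, Set.mem_preimage, exists_prop] at hx hy
  obtain ⟨i, him, hxi⟩ := hx
  obtain ⟨j, hjm, hyj⟩ := hy
  have hxA : x ∈ A i := by
    obtain ⟨z, hz, hzx⟩ := hKsub i hxi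
    exact hinj hz.2 hxY hzx ▸ hz.1
  have hyA : y ∈ A j := by
    obtain ⟨z, hz, hzx⟩ := hKsub j hyj
    exact hinj hz.2 hyY hzx ▸ hz.1
  by_cases hij : i = j
  · subst hij
    exact Or.inl ⟨i, hxA, hyA⟩
  · right
    have hmem : (F x, F y) ∈ Q := by
      simp only [Q, Set.mem_iUnion, Finset.mem_filter, Finset.mem_product, Finset.mem_range]
      exact ⟨(i, j), ⟨⟨him, hjm⟩, hij⟩, hxi, hyj⟩
    have := ht hmem
    simp only [Set.mem_iUnion] at this
    obtain ⟨c, hct, hc⟩ := this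
    refine ⟨c.1, Finset.mem_image_of_mem _ hct, le_trans ?_ (le_of_lt hc)⟩
    have : (c.2 : ℝ) ≤ (t.sup Prod.snd : ℕ) := by exact_mod_cast Finset.le_sup (f := Prod.snd) hct
    gcongr

/-! ### Separation by finitely many shifts -/

/-- A summable semimetric that is separable on a set of full measure has a sequence of centres,
dense almost everywhere, at which the distance function is integrable. -/
theorem exists_dense_integrable_seq {X : Type*} [MeasurableSpace X] {μ : Measure X}
    [IsProbabilityMeasure μ] {ρ : X → X → ℝ} (hρ : IsAdmissible μ ρ) (hs : IsSummable μ ρ) :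
    ∃ e : ℕ → X, (∀ i, Integrable (ρ (e i)) μ) ∧ ∀ᵐ x ∂μ, ∀ ε : ℝ, 0 < ε → ∃ i, ρ (e i) x < ε := by
  classical
  obtain ⟨X₁, hX₁, D, -, hDc, hD⟩ := hρ.separable
  have hint : ∀ᵐ x ∂μ, Integrable (ρ x) μ := Integrable.prod_right_ae hs
  obtain ⟨x₀, hx₀⟩ := hint.exists
  have := hDc.to_subtype
  -- The given dense set may lie in the null set of points with non-integrable distance function, so
  -- each of its points is replaced by nearby integrable ones where these exist, and by `x₀`
  -- otherwise.
  let S : D × ℕ → Prop := fun p => ∃ z, Integrable (ρ z) μ ∧ ρ z p.1 < 1 / ((p.2 : ℝ) + 1)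
  let E : Set X := insert x₀ (Set.range fun p : D × ℕ => if h : S p then h.choose else x₀)
  have hEc : E.Countable := (Set.countable_range _).insert _
  obtain ⟨e, he⟩ := hEc.exists_eq_range ⟨x₀, Set.mem_insert _ _⟩
  refine ⟨e, fun i => ?_, ?_⟩
  · have : e i ∈ E := he ▸ Set.mem_range_self i
    rcases this with h | ⟨p, h⟩
    · rw [h]; exact hx₀
    · rw [← h]
      dsimp only
      split_ifs with hp
      · exact hp.choose_spec.1
      · exact hx₀
  · filter_upwards [hint, measure_eq_zero_iff_ae_notMem.1 hX₁] with x hx hx1 ε hε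
    obtain ⟨n, hn⟩ := exists_nat_one_div_lt (half_pos hε)
    obtain ⟨d, hd, hxd⟩ := hD x (by simpa using hx1) (1 / ((n : ℝ) + 1)) (by positivity)
    have hp : S (⟨d, hd⟩, n) := ⟨x, hx, hxd⟩
    have hmem : hp.choose ∈ E := Or.inr ⟨(⟨d, hd⟩, n), by dsimp only; rw [dif_pos hp]⟩
    rw [he] at hmem
    obtain ⟨i, hi⟩ := hmem
    refine ⟨i, ?_⟩
    have h1 := hp.choose_spec.2
    rw [← hi] at h1
    have h2 := hρ.triangle (e i) d x
    rw [hρ.symm d x] at h2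
    dsimp only at h1
    linarith

theorem measurePreserving_zpow {X : Type*} [MeasurableSpace X] {μ : Measure X} {T : X ≃ᵐ X}
    (hT : MeasurePreserving T μ μ) (k : ℤ) :
    MeasurePreserving (⇑((T.toEquiv : Equiv.Perm X) ^ k)) μ μ := by
  have hpos : ∀ n : ℕ, MeasurePreserving (⇑((T.toEquiv : Equiv.Perm X) ^ n)) μ μ := by
    intro n
    rw [← Equiv.Perm.iterate_eq_pow]
    exact hT.iterate n
  have hneg : ∀ n : ℕ, MeasurePreserving (⇑((T.toEquiv⁻¹ : Equiv.Perm X) ^ n)) μ μ := by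
    intro n
    rw [← Equiv.Perm.iterate_eq_pow]
    exact (hT.symm T).iterate n
  obtain ⟨n, rfl | rfl⟩ := k.eq_nat_or_neg
  · rw [zpow_natCast]; exact hpos n
  · rw [zpow_neg, zpow_natCast, ← inv_pow]; exact hneg n

theorem IsSemimetric.abs_sub_le {X : Type*} {ρ : X → X → ℝ} (hρ : IsSemimetric ρ) (e x y : X) :
    |ρ e x - ρ e y| ≤ ρ x y := by
  have h1 := hρ.triangle e y x
  have h2 := hρ.triangle e x y
  rw [hρ.symm y x] at h1
  exact abs_sub_le_iff.2 ⟨by linarith, by linarith⟩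

/-- Off a set of small measure, points that are not `ε`-close for `ρ'` are uniformly separated by
finitely many shifts of the generating semimetric `ρ`. -/
theorem exists_separating_shifts {X : Type*} [MeasurableSpace X] [StandardBorelSpace X]
    {μ : Measure X} [IsProbabilityMeasure μ] {T : X ≃ᵐ X} (hT : MeasurePreserving T μ μ)
    {ρ ρ' : X → X → ℝ} (hρ : IsAdmissible μ ρ) (hρ' : IsAdmissible μ ρ')
    (hs : IsSummable μ ρ) (hs' : IsSummable μ ρ') (hgen : IsGenerating μ T ρ)
    {ε : ℝ} (hε : 0 < ε) {β : ℝ≥0∞} (hβ : β ≠ 0) :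
    ∃ G : Set X, MeasurableSet G ∧ μ Gᶜ < β ∧ ∃ J : Finset ℤ, ∃ δ : ℝ, 0 < δ ∧
      ∀ x ∈ G, ∀ y ∈ G, ρ' x y < ε ∨ δ ≤ ∑ j ∈ J, shift T j ρ x y := by
  classical
  obtain ⟨e, heint, hedense⟩ := exists_dense_integrable_seq hρ hs
  obtain ⟨e', heint', hedense'⟩ := exists_dense_integrable_seq hρ' hs'
  obtain ⟨X', -, hX', hsep⟩ := hgen
  let τ : ℤ → X → X := fun k => ⇑((T.toEquiv : Equiv.Perm X) ^ k)
  have hτ : ∀ k, MeasurePreserving (τ k) μ μ := measurePreserving_zpow hT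
  have hm : ∀ i, AEMeasurable (ρ (e i)) μ := fun i => (heint i).aestronglyMeasurable.aemeasurable
  have hm' : ∀ i, AEMeasurable (ρ' (e' i)) μ := fun i =>
    (heint' i).aestronglyMeasurable.aemeasurable
  let g : ℕ → X → ℝ := fun i => (hm i).mk
  let g' : ℕ → X → ℝ := fun i => (hm' i).mk
  have hgood : ∀ᵐ x ∂μ, x ∈ X' ∧
      (∀ j, (∀ δ : ℝ, 0 < δ → ∃ i, ρ (e i) (τ j x) < δ) ∧ ∀ i, ρ (e i) (τ j x) = g i (τ j x)) ∧
      (∀ δ : ℝ, 0 < δ → ∃ i, ρ' (e' i) x < δ) ∧ ∀ i, ρ' (e' i) x = g' i x := by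
    have h1 : ∀ᵐ x ∂μ, ∀ i, ρ (e i) x = g i x := ae_all_iff.2 fun i => (hm i).ae_eq_mk
    have h2 : ∀ᵐ x ∂μ, ∀ i, ρ' (e' i) x = g' i x := ae_all_iff.2 fun i => (hm' i).ae_eq_mk
    have h3 := ae_all_iff.2 fun j => (hτ j).quasiMeasurePreserving.ae (hedense.and h1)
    have h4 : ∀ᵐ x ∂μ, x ∈ X' := by
      filter_upwards [measure_eq_zero_iff_ae_notMem.1 hX'] with x hx
      simpa using hx
    filter_upwards [h4, h3, hedense', h2] with x a b c d
    exact ⟨a, b, c, d⟩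
  obtain ⟨N, hN, hNmeas, hN0⟩ := exists_measurable_superset_of_null (ae_iff.1 hgood)
  have hY : ∀ x ∈ Nᶜ, x ∈ X' ∧
      (∀ j, (∀ δ : ℝ, 0 < δ → ∃ i, ρ (e i) (τ j x) < δ) ∧ ∀ i, ρ (e i) (τ j x) = g i (τ j x)) ∧
      (∀ δ : ℝ, 0 < δ → ∃ i, ρ' (e' i) x < δ) ∧ ∀ i, ρ' (e' i) x = g' i x := by
    intro x hx
    by_contra h
    exact hx (hN h)
  let F : X → ℤ × ℕ → ℝ := fun x c => g c.2 (τ c.1 x)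
  have hF : Measurable F :=
    measurable_pi_lambda _ fun c => (hm c.2).measurable_mk.comp (hτ c.1).measurable
  have hFdist : ∀ x ∈ Nᶜ, ∀ y ∈ Nᶜ, ∀ c, |F x c - F y c| ≤ shift T c.1 ρ x y := by
    intro x hx y hy c
    have := hρ.toIsSemimetric.abs_sub_le (e c.2) (τ c.1 x) (τ c.1 y)
    rwa [((hY x hx).2.1 c.1).2, ((hY y hy).2.1 c.1).2] at this
  -- If `F x = F y`, a centre within half of `shift T k ρ x y` of `τ k x` is equally close to `τ k
  -- y`, against the triangle inequality.
  have hinj : Set.InjOn F Nᶜ := by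
    intro x hx y hy hxy
    by_contra hne
    obtain ⟨k, hk⟩ := hsep x (hY x hx).1 y (hY y hy).1 hne
    obtain ⟨i, hi⟩ := ((hY x hx).2.1 k).1 _ (half_pos hk)
    have h1 : ρ (e i) (τ k x) = ρ (e i) (τ k y) := by
      rw [((hY x hx).2.1 k).2, ((hY y hy).2.1 k).2]
      exact congrFun hxy (k, i)
    have h2 := hρ.triangle (τ k x) (e i) (τ k y)
    rw [hρ.symm _ (e i)] at h2
    have h3 : shift T k ρ x y = ρ (τ k x) (τ k y) := rfl
    linarith
  -- Off `N` these are `ρ'`-balls of radius `ε / 2`, so two points of one cell are `ε`-close.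
  let B : ℕ → Set X := fun i => {x | g' i x < ε / 2}
  have hB : ∀ i, MeasurableSet (B i) := fun i =>
    measurableSet_lt (hm' i).measurable_mk measurable_const
  have hcover : μ (⋃ i, disjointed B i)ᶜ = 0 := by
    refine measure_mono_null (fun x hx => ?_) hN0
    by_contra hxN
    obtain ⟨i, hi⟩ := (hY x hxN).2.2.1 _ (half_pos hε)
    rw [iUnion_disjointed] at hx
    rw [(hY x hxN).2.2.2] at hi
    exact hx (Set.mem_iUnion.2 ⟨i, hi⟩)
  obtain ⟨G, hG, hGβ, J, δ, hδ, hJ⟩ := exists_separating_coordinates μ hF hNmeas.compl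
    (by rwa [compl_compl]) hinj (fun i => MeasurableSet.disjointed hB i) (disjoint_disjointed B)
    hcover hβ
  refine ⟨G ∩ Nᶜ, hG.inter hNmeas.compl, ?_, J.image Prod.fst, δ, hδ, ?_⟩
  · rw [Set.compl_inter, compl_compl]
    exact (measure_union_le _ _).trans_lt (by rwa [hN0, add_zero])
  · rintro x ⟨hxG, hx⟩ y ⟨hyG, hy⟩
    rcases hJ x hxG y hyG with ⟨i, hxi, hyi⟩ | ⟨c, hc, hle⟩
    · left
      have h1 : g' i x < ε / 2 := disjointed_subset B i hxi
      have h2 : g' i y < ε / 2 := disjointed_subset B i hyi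
      rw [← (hY x hx).2.2.2] at h1
      rw [← (hY y hy).2.2.2] at h2
      have h3 := hρ'.triangle x (e' i) y
      rw [hρ'.symm x (e' i)] at h3
      linarith
    · right
      refine (hle.trans (hFdist x hx y hy c)).trans ?_
      exact Finset.single_le_sum (f := fun j => shift T j ρ x y) (fun j _ => hρ.nonneg _ _)
        (Finset.mem_image_of_mem _ hc)

/-! ### Domination by finitely many shifts -/

/-- Dominated convergence. This truncation handles unbounded `ρ'`: through a centre, `ρ' x y` is at
most `2 * M` plus the excesses at `x` and `y`. -/
theorem exists_integral_excess_lt {X : Type*} [MeasurableSpace X] {μ : Measure X} {v : X → ℝ}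
    (hv : Integrable v μ) {η : ℝ} (hη : 0 < η) :
    ∃ M : ℝ, 0 ≤ M ∧ Integrable (fun x => max (v x - M) 0) μ ∧ ∫ x, max (v x - M) 0 ∂μ < η := by
  have hmeas : ∀ n : ℕ, AEStronglyMeasurable (fun x => max (v x - n) 0) μ := fun n =>
    (hv.aestronglyMeasurable.sub aestronglyMeasurable_const).sup aestronglyMeasurable_const
  have hle : ∀ (n : ℕ) (x : X), ‖max (v x - n) 0‖ ≤ ‖v x‖ := by
    intro n x
    rw [Real.norm_of_nonneg (le_max_right _ _), Real.norm_eq_abs]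
    exact max_le (by linarith [le_abs_self (v x), n.cast_nonneg (α := ℝ)]) (abs_nonneg _)
  have hlim : Tendsto (fun n : ℕ => ∫ x, max (v x - n) 0 ∂μ) atTop (𝓝 (∫ _, (0 : ℝ) ∂μ)) := by
    refine tendsto_integral_of_dominated_convergence (fun x => ‖v x‖) hmeas hv.norm
      (fun n => Eventually.of_forall (hle n)) (Eventually.of_forall fun x => ?_)
    obtain ⟨m, hm⟩ := exists_nat_ge (v x)
    refine tendsto_const_nhds.congr' ?_
    filter_upwards [eventually_ge_atTop m] with n hn
    have : (m : ℝ) ≤ n := by exact_mod_cast hn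
    rw [max_eq_right (by linarith)]
  rw [integral_zero] at hlim
  obtain ⟨n, hn⟩ := (hlim.eventually_lt_const hη).exists
  exact ⟨n, n.cast_nonneg, hv.mono (hmeas n) (Eventually.of_forall (hle n)), hn⟩

/-- An admissible summable semimetric is dominated by a multiple of finitely many shifts of a
generating one, up to a term of small integral. -/
theorem exists_domination {X : Type*} [MeasurableSpace X] [StandardBorelSpace X]
    {μ : Measure X} [IsProbabilityMeasure μ] {T : X ≃ᵐ X} (hT : MeasurePreserving T μ μ)
    {ρ ρ' : X → X → ℝ} (hρ : IsAdmissible μ ρ) (hρ' : IsAdmissible μ ρ')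
    (hs : IsSummable μ ρ) (hs' : IsSummable μ ρ') (hgen : IsGenerating μ T ρ)
    {η : ℝ} (hη : 0 < η) :
    ∃ C : ℝ, 0 ≤ C ∧ ∃ J : Finset ℤ, ∃ u : X → ℝ, (∀ x, 0 ≤ u x) ∧ Integrable u μ ∧
      ∫ x, u x ∂μ < η ∧ ∀ x y, ρ' x y ≤ C * ∑ j ∈ J, shift T j ρ x y + (u x + u y) := by
  obtain ⟨e, he, -⟩ := exists_dense_integrable_seq hρ' hs'
  obtain ⟨M, hM, hMint, hMη⟩ := exists_integral_excess_lt (he 0) (show (0 : ℝ) < η / 3 by positivity)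
  -- Makes `2 * M * b ≤ η / 3`; the `+ 1` covers `M = 0`.
  let b : ℝ := η / 3 / (2 * M + 1)
  have hb : 0 < b := by positivity
  obtain ⟨G, hG, hGb, J, δ, hδ, hJ⟩ := exists_separating_shifts hT hρ hρ' hs hs' hgen
    (show (0 : ℝ) < η / 3 by positivity) (β := ENNReal.ofReal b) (ENNReal.ofReal_pos.2 hb).ne'
  -- The terms pay for the excess over `M`, for close pairs in `G`, and for pairs meeting `Gᶜ`. For
  -- separated pairs in `G` the multiple `2 * M / δ` of the shifts pays for `2 * M`.
  let u : X → ℝ := fun x => max (ρ' (e 0) x - M) 0 + (η / 3 + Gᶜ.indicator (fun _ => 2 * M) x)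
  have hind : ∀ x, 0 ≤ Gᶜ.indicator (fun _ => 2 * M) x := fun x =>
    Set.indicator_nonneg (fun _ _ => by positivity) x
  have hindint : Integrable (Gᶜ.indicator fun _ => 2 * M) μ :=
    (integrable_const _).indicator hG.compl
  have hsum : ∀ x y, 0 ≤ ∑ j ∈ J, shift T j ρ x y := fun x y =>
    Finset.sum_nonneg fun j _ => hρ.nonneg _ _
  refine ⟨2 * M / δ, by positivity, J, u, fun x => ?_, ?_, ?_, fun x y => ?_⟩
  · have := hind x
    have := le_max_right (ρ' (e 0) x - M) 0
    simp only [u]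
    linarith
  · exact hMint.add ((integrable_const _).add hindint)
  · have h1 : ∫ x, u x ∂μ = ∫ x, max (ρ' (e 0) x - M) 0 ∂μ + (η / 3 + μ.real Gᶜ * (2 * M)) := by
      have h2 : ∫ x, η / 3 + Gᶜ.indicator (fun _ => 2 * M) x ∂μ = η / 3 + μ.real Gᶜ * (2 * M) := by
        rw [integral_add (integrable_const _) hindint, integral_indicator_const _ hG.compl]
        simp
      rw [← h2]
      exact integral_add hMint ((integrable_const _).add hindint)
    have h2 : μ.real Gᶜ ≤ b := ENNReal.toReal_le_of_le_ofReal hb.le hGb.le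
    have h3 : μ.real Gᶜ * (2 * M) ≤ η / 3 := by
      calc μ.real Gᶜ * (2 * M) ≤ b * (2 * M + 1) := by gcongr; linarith
        _ = η / 3 := by simp only [b]; field_simp
    linarith
  · have h1 := hρ'.triangle x (e 0) y
    rw [hρ'.symm x (e 0)] at h1
    have h2 := le_max_left (ρ' (e 0) x - M) 0
    have h3 := le_max_left (ρ' (e 0) y - M) 0
    have h2' := le_max_right (ρ' (e 0) x - M) 0
    have h3' := le_max_right (ρ' (e 0) y - M) 0
    have h4 := hind x
    have h5 := hind y
    have h6 : 0 ≤ 2 * M / δ * ∑ j ∈ J, shift T j ρ x y := mul_nonneg (by positivity) (hsum x y)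
    simp only [u]
    by_cases hx : x ∈ G
    · by_cases hy : y ∈ G
      · rcases hJ x hx y hy with h | h
        · linarith
        · have h7 : 2 * M ≤ 2 * M / δ * ∑ j ∈ J, shift T j ρ x y := by
            calc 2 * M = 2 * M / δ * δ := by field_simp
              _ ≤ _ := by gcongr
          linarith
      · have : Gᶜ.indicator (fun _ => 2 * M) y = 2 * M := Set.indicator_of_mem hy _
        linarith
    · have : Gᶜ.indicator (fun _ => 2 * M) x = 2 * M := Set.indicator_of_mem hx _
      linarith

/-! ### Domination of averages -/

theorem sum_Ico_shift_le {a : ℤ → ℝ} (ha : ∀ k, 0 ≤ a k) (n : ℕ) (j : ℤ) :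
    ∑ k ∈ Finset.range n, a (k + j) ≤
      ∑ k ∈ Finset.range n, a k + ∑ k ∈ Finset.Ico j (n + j) \ Finset.Ico 0 (n : ℤ), a k := by
  have h1 : ∑ k ∈ Finset.range n, a (k + j) = ∑ k ∈ Finset.Ico j (n + j), a k := by
    refine Finset.sum_bij (fun k _ => (k : ℤ) + j) ?_ ?_ ?_ ?_
    · intro k hk; simp at hk ⊢; omega
    · intro k _ l _ h; omega
    · intro k hk
      simp at hk
      exact ⟨(k - j).toNat, by simp; omega, by omega⟩
    · intro k _; rfl
  have h2 : ∑ k ∈ Finset.range n, a k = ∑ k ∈ Finset.Ico 0 (n : ℤ), a k := by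
    refine Finset.sum_bij (fun k _ => (k : ℤ)) ?_ ?_ ?_ ?_
    · intro k hk; simp at hk ⊢; omega
    · intro k _ l _ h; omega
    · intro k hk
      simp at hk
      exact ⟨k.toNat, by simp; omega, by omega⟩
    · intro k _; rfl
  rw [h1, h2, ← Finset.sum_inter_add_sum_sdiff (Finset.Ico j (n + j)) (Finset.Ico 0 (n : ℤ))]
  gcongr
  · exact fun k _ _ => ha k
  · exact Finset.inter_subset_right

theorem card_Ico_sdiff_le (n : ℕ) (j : ℤ) :
    (Finset.Ico j (n + j) \ Finset.Ico 0 (n : ℤ)).card ≤ j.natAbs := by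
  rcases le_total 0 j with h | h
  · calc _ ≤ (Finset.Ico (n : ℤ) (n + j)).card := Finset.card_le_card fun k hk => by
          simp at hk ⊢; omega
      _ ≤ _ := by rw [Int.card_Ico]; omega
  · calc _ ≤ (Finset.Ico j 0).card := Finset.card_le_card fun k hk => by
          simp at hk ⊢; omega
      _ ≤ _ := by rw [Int.card_Ico]; omega

/-- Averages of `ρ'` are dominated by averages of the generating semimetric `ρ`, up to a term of
small integral. -/
theorem exists_average_domination {X : Type*} [MeasurableSpace X] [StandardBorelSpace X]
    {μ : Measure X} [IsProbabilityMeasure μ] {T : X ≃ᵐ X} (hT : MeasurePreserving T μ μ)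
    {ρ ρ' : X → X → ℝ} (hρ : IsAdmissible μ ρ) (hρ' : IsAdmissible μ ρ')
    (hs : IsSummable μ ρ) (hs' : IsSummable μ ρ') (hgen : IsGenerating μ T ρ)
    {η : ℝ} (hη : 0 < η) :
    ∃ C : ℝ, 0 ≤ C ∧ ∀ᶠ n in atTop, ∃ w : X → ℝ, (∀ x, 0 ≤ w x) ∧ Integrable w μ ∧
      ∫ x, w x ∂μ < η ∧
      ∀ x y, average T n ρ' x y ≤ C * average T n ρ x y + (w x + w y) := by
  obtain ⟨C, hC, J, u, hu, huint, huη, hdom⟩ :=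
    exists_domination hT hρ hρ' hs hs' hgen (half_pos hη)
  obtain ⟨e, he, -⟩ := exists_dense_integrable_seq hρ hs
  let v : X → ℝ := ρ (e 0)
  have hv : ∀ x, 0 ≤ v x := hρ.nonneg _
  let τ : ℤ → X → X := fun k => ⇑((T.toEquiv : Equiv.Perm X) ^ k)
  have hτ : ∀ k, MeasurePreserving (τ k) μ μ := measurePreserving_zpow hT
  have hτemb : ∀ k, MeasurableEmbedding (τ k) := fun k =>
    (hτ k).measurable.measurableEmbedding (Equiv.injective _)
  have hτint : ∀ (f : X → ℝ) k, ∫ x, f (τ k x) ∂μ = ∫ x, f x ∂μ := fun f k =>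
    (hτ k).integral_comp (hτemb k) f
  have hcomp : ∀ {f : X → ℝ}, Integrable f μ → ∀ k, Integrable (fun x => f (τ k x)) μ :=
    fun hf k => (hτ k).integrable_comp_of_integrable hf
  have hadd : ∀ (k j : ℤ) x, τ j (τ k x) = τ (k + j) x := by
    intro k j x
    simp only [τ]
    rw [add_comm, zpow_add, Equiv.Perm.mul_apply]
  let E : ℕ → ℤ → Finset ℤ := fun n j => Finset.Ico j (n + j) \ Finset.Ico 0 (n : ℤ)
  -- Bounds the integral of all edge terms uniformly in `n`, since `E n j` has at most `|j|`
  -- elements; division by `n` makes it negligible.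
  let D : ℝ := C * ∑ j ∈ J, (j.natAbs : ℝ) * ∫ x, v x ∂μ
  have hlim : Tendsto (fun n : ℕ => D / (n : ℝ)) atTop (𝓝 0) :=
    tendsto_const_div_atTop_nhds_zero_nat D
  -- Each shift in `J` costs one full copy of the average of `ρ`.
  refine ⟨C * J.card, by positivity, ?_⟩
  filter_upwards [hlim.eventually_lt_const (half_pos hη), eventually_gt_atTop 0] with n hn hn0
  have hn0' : (0 : ℝ) < n := by exact_mod_cast hn0
  let w : X → ℝ := fun x => (1 / (n : ℝ)) *
    (∑ k ∈ Finset.range n, u (τ k x) + C * ∑ j ∈ J, ∑ k ∈ E n j, v (τ k x))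
  have hint1 : Integrable (fun x => ∑ k ∈ Finset.range n, u (τ k x)) μ :=
    integrable_finsetSum _ fun k _ => hcomp huint k
  have hint2' : ∀ j ∈ J, Integrable (fun x => ∑ k ∈ E n j, v (τ k x)) μ := fun j _ =>
    integrable_finsetSum _ fun k _ => hcomp (he 0) k
  have hint2 : Integrable (fun x => C * ∑ j ∈ J, ∑ k ∈ E n j, v (τ k x)) μ :=
    (integrable_finsetSum _ hint2').const_mul C
  refine ⟨w, fun x => ?_, (hint1.add hint2).const_mul _, ?_, fun x y => ?_⟩
  · refine mul_nonneg (by positivity) (add_nonneg (Finset.sum_nonneg fun _ _ => hu _) ?_)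
    exact mul_nonneg hC (Finset.sum_nonneg fun _ _ => Finset.sum_nonneg fun _ _ => hv _)
  · have h1 : ∫ x, w x ∂μ = (1 / (n : ℝ)) *
        (n * ∫ x, u x ∂μ + C * ∑ j ∈ J, ((E n j).card : ℝ) * ∫ x, v x ∂μ) := by
      simp only [w]
      rw [integral_const_mul, integral_add hint1 hint2, integral_const_mul,
        integral_finsetSum (Finset.range n) (fun k _ => hcomp huint (k : ℤ)),
        integral_finsetSum _ hint2']
      congr 3
      · rw [Finset.sum_congr rfl fun (k : ℕ) _ => hτint u k]
        simp
      · refine Finset.sum_congr rfl fun j _ => ?_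
        rw [integral_finsetSum _ (fun k _ => hcomp (he 0) k),
          Finset.sum_congr rfl fun k _ => hτint v k]
        simp
    have h2 : C * ∑ j ∈ J, ((E n j).card : ℝ) * ∫ x, v x ∂μ ≤ D := by
      refine mul_le_mul_of_nonneg_left (Finset.sum_le_sum fun j _ => ?_) hC
      refine mul_le_mul_of_nonneg_right ?_ (integral_nonneg hv)
      exact_mod_cast card_Ico_sdiff_le n j
    calc ∫ x, w x ∂μ ≤ (1 / (n : ℝ)) * (n * ∫ x, u x ∂μ + D) := by rw [h1]; gcongr
      _ = ∫ x, u x ∂μ + D / n := by field_simp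
      _ < η := by linarith
  · have hshift : ∀ k : ℕ, shift T k ρ' x y ≤
        C * ∑ j ∈ J, shift T (k + j) ρ x y + (u (τ k x) + u (τ k y)) := by
      intro k
      have h := hdom (τ k x) (τ k y)
      have h' : ∀ j, shift T j ρ (τ k x) (τ k y) = shift T (k + j) ρ x y := by
        intro j
        change ρ (τ j (τ k x)) (τ j (τ k y)) = ρ (τ (k + j) x) (τ (k + j) y)
        rw [hadd, hadd]
      simp only [h'] at h
      exact h
    have hv2 : ∀ k, shift T k ρ x y ≤ v (τ k x) + v (τ k y) := by
      intro k
      have h := hρ.triangle (τ k x) (e 0) (τ k y)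
      rwa [hρ.symm _ (e 0)] at h
    have hsum : ∑ k ∈ Finset.range n, shift T k ρ' x y ≤
        C * ∑ j ∈ J, (∑ k ∈ Finset.range n, shift T k ρ x y +
          ∑ k ∈ E n j, (v (τ k x) + v (τ k y))) +
        ∑ k ∈ Finset.range n, (u (τ k x) + u (τ k y)) := by
      calc ∑ k ∈ Finset.range n, shift T k ρ' x y
          ≤ ∑ k ∈ Finset.range n,
            (C * ∑ j ∈ J, shift T (k + j) ρ x y + (u (τ k x) + u (τ k y))) :=
            Finset.sum_le_sum fun k _ => hshift k
        _ = C * ∑ j ∈ J, ∑ k ∈ Finset.range n, shift T (k + j) ρ x y +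
            ∑ k ∈ Finset.range n, (u (τ k x) + u (τ k y)) := by
            rw [Finset.sum_add_distrib, ← Finset.mul_sum, Finset.sum_comm]
        _ ≤ _ := by
            gcongr with j hj
            refine (sum_Ico_shift_le (a := fun k => shift T k ρ x y)
              (fun k => hρ.nonneg _ _) n j).trans ?_
            gcongr with k hk
            exact hv2 k
    have h := mul_le_mul_of_nonneg_left hsum (show (0 : ℝ) ≤ 1 / (n : ℝ) by positivity)
    refine h.trans (le_of_eq ?_)
    simp only [average, w, Finset.sum_add_distrib, Finset.sum_const, nsmul_eq_mul]
    ring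

/-! ### Comparison of entropies and of scaling sequences -/

theorem diam_lt_of_forall_le {X : Type*} {ρ : X → X → ℝ} {A : Set X} {r ε : ℝ} (hε : 0 < ε)
    (hr : r < ε) (h : ∀ x ∈ A, ∀ y ∈ A, ρ x y ≤ r) : diam ρ A < ENNReal.ofReal ε := by
  refine lt_of_le_of_lt ?_ ((ENNReal.ofReal_lt_ofReal_iff hε).2 hr)
  exact iSup₂_le fun x hx => iSup₂_le fun y hy => ENNReal.ofReal_le_ofReal (h x hx y hy)

theorem le_of_diam_lt {X : Type*} {ρ : X → X → ℝ} {A : Set X} {ε : ℝ} (hε : 0 < ε)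
    (h : diam ρ A < ENNReal.ofReal ε) {x y : X} (hx : x ∈ A) (hy : y ∈ A) : ρ x y ≤ ε := by
  have h1 : ENNReal.ofReal (ρ x y) ≤ diam ρ A :=
    (le_iSup₂_of_le (f := fun y (_ : y ∈ A) => ENNReal.ofReal (ρ x y)) y hy le_rfl).trans
      (le_iSup₂ (f := fun x (_ : x ∈ A) => ⨆ y ∈ A, ENNReal.ofReal (ρ x y)) x hx)
  exact (ENNReal.ofReal_le_ofReal_iff hε.le).1 (h1.trans h.le)

/-- Partitions transfer along a domination up to an additive term of small integral. -/
theorem HasPartition.of_le {X : Type*} [MeasurableSpace X] {μ : Measure X}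
    {ρ ρ' : X → X → ℝ} {w : X → ℝ} {C ε δ : ℝ} (hε : 0 < ε)
    (hδ : 0 < δ) (hC : 0 ≤ C) (hCδ : C * δ ≤ ε / 4) (hδε : δ ≤ ε / 2)
    (hw : ∀ x, 0 ≤ w x) (hwint : Integrable w μ) (hwε : ∫ x, w x ∂μ < ε / 4 * (ε / 2))
    (hle : ∀ x y, ρ' x y ≤ C * ρ x y + (w x + w y)) {k : ℕ} (hk : HasPartition μ ρ δ k) :
    HasPartition μ ρ' ε k := by
  obtain ⟨P, hPm, hPd, hPU, hP0, hPdiam⟩ := hk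
  -- By Markov `B` has measure below `ε / 2`. Moving it into cell `0` keeps `k`; outside it the
  -- diameters are at most `C * δ + ε / 4 + ε / 4 ≤ 3 * ε / 4`.
  let B : Set X := {x | ε / 4 ≤ w x}
  have hB : NullMeasurableSet B μ := hwint.aestronglyMeasurable.aemeasurable.nullMeasurable
    measurableSet_Ici
  have hBμ : μ B < ENNReal.ofReal (ε / 2) := by
    have h1 := mul_meas_ge_le_lintegral₀ hwint.aestronglyMeasurable.aemeasurable.ennreal_ofReal
      (ENNReal.ofReal (ε / 4))
    rw [← ofReal_integral_eq_lintegral_ofReal hwint (Eventually.of_forall hw)] at h1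
    have h2 : {x | ENNReal.ofReal (ε / 4) ≤ ENNReal.ofReal (w x)} = B := by
      ext x
      exact ENNReal.ofReal_le_ofReal_iff (hw x)
    rw [h2] at h1
    have h3 : ENNReal.ofReal (∫ x, w x ∂μ) < ENNReal.ofReal (ε / 4) * ENNReal.ofReal (ε / 2) := by
      rw [← ENNReal.ofReal_mul (by positivity)]
      exact (ENNReal.ofReal_lt_ofReal_iff (by positivity)).2 hwε
    exact lt_of_mul_lt_mul_left' (h1.trans_lt h3)
  refine ⟨Fin.cons (P 0 ∪ B) fun j => P j.succ \ B, ?_, ?_, ?_, ?_, ?_⟩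
  · intro i
    refine Fin.cases ?_ (fun j => ?_) i
    · exact (hPm 0).union hB
    · exact (hPm _).diff hB
  · have h0 : ∀ j : Fin k, Disjoint (P 0 ∪ B) (P j.succ \ B) := by
      intro j
      refine Set.disjoint_union_left.2 ⟨?_, Set.disjoint_sdiff_right⟩
      exact (hPd (Fin.succ_ne_zero j).symm).mono_right Set.sdiff_subset
    intro i j
    refine Fin.cases ?_ (fun i => ?_) i <;> refine Fin.cases ?_ (fun j => ?_) j
    · exact fun h => absurd rfl h
    · exact fun _ => h0 j
    · exact fun _ => (h0 i).symm
    · exact fun h => (hPd h).mono Set.sdiff_subset Set.sdiff_subset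
  · refine Set.eq_univ_of_forall fun x => ?_
    by_cases hx : x ∈ B
    · exact Set.mem_iUnion.2 ⟨0, Or.inr hx⟩
    · obtain ⟨i, hi⟩ := Set.mem_iUnion.1 (hPU ▸ Set.mem_univ x : x ∈ ⋃ i, P i)
      refine Set.mem_iUnion.2 ⟨i, ?_⟩
      revert hi
      refine Fin.cases (fun hi => ?_) (fun j hi => ?_) i
      · exact Or.inl hi
      · exact ⟨hi, hx⟩
  · calc μ (P 0 ∪ B) ≤ μ (P 0) + μ B := measure_union_le _ _
      _ < ENNReal.ofReal δ + ENNReal.ofReal (ε / 2) := ENNReal.add_lt_add hP0 hBμ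
      _ ≤ ENNReal.ofReal ε := by
        rw [← ENNReal.ofReal_add hδ.le (by positivity)]
        exact ENNReal.ofReal_le_ofReal (by linarith)
  · intro j
    refine diam_lt_of_forall_le (r := 3 * ε / 4) hε (by linarith) fun x hx y hy => ?_
    have h1 := le_of_diam_lt hδ (hPdiam j) hx.1 hy.1
    have h2 := mul_le_mul_of_nonneg_left h1 hC
    have h3 := hle x y
    have h4 : w x < ε / 4 := not_le.1 hx.2
    have h5 : w y < ε / 4 := not_le.1 hy.2
    linarith

theorem epsEntropy_le_of_imp {X : Type*} [MeasurableSpace X] {μ : Measure X}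
    {ρ ρ' : X → X → ℝ} {ε δ : ℝ} (h : ∀ k, HasPartition μ ρ δ k → HasPartition μ ρ' ε k) :
    epsEntropy μ ρ' ε ≤ epsEntropy μ ρ δ := by
  classical
  unfold epsEntropy
  split_ifs with h1 h2 h2
  · refine ENNReal.ofReal_le_ofReal (Real.logb_le_logb_of_le one_lt_two ?_ ?_)
    · exact_mod_cast (Nat.find_spec h1).1
    · exact_mod_cast Nat.find_min' h1 ⟨(Nat.find_spec h2).1, h _ (Nat.find_spec h2).2⟩
  · exact le_top
  · obtain ⟨k, hk, hp⟩ := h2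
    exact absurd ⟨k, hk, h k hp⟩ h1
  · exact le_rfl

theorem epsEntropy_anti {X : Type*} [MeasurableSpace X] {μ : Measure X} {ρ : X → X → ℝ}
    {δ ε : ℝ} (h : δ ≤ ε) : epsEntropy μ ρ ε ≤ epsEntropy μ ρ δ :=
  epsEntropy_le_of_imp fun _ ⟨P, h1, h2, h3, h4, h5⟩ =>
    ⟨P, h1, h2, h3, h4.trans_le (ENNReal.ofReal_le_ofReal h),
      fun j => (h5 j).trans_le (ENNReal.ofReal_le_ofReal h)⟩

/-- The entropies of the averages of `ρ'` are eventually bounded by those of a generating `ρ`. -/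
theorem exists_eventually_epsEntropy_le {X : Type*} [MeasurableSpace X] [StandardBorelSpace X]
    {μ : Measure X} [IsProbabilityMeasure μ] {T : X ≃ᵐ X} (hT : MeasurePreserving T μ μ)
    {ρ ρ' : X → X → ℝ} (hρ : IsAdmissible μ ρ) (hρ' : IsAdmissible μ ρ')
    (hs : IsSummable μ ρ) (hs' : IsSummable μ ρ') (hgen : IsGenerating μ T ρ)
    {ε : ℝ} (hε : 0 < ε) :
    ∃ δ : ℝ, 0 < δ ∧ ∀ᶠ n in atTop,
      epsEntropy μ (average T n ρ') ε ≤ epsEntropy μ (average T n ρ) δ := by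
  obtain ⟨C, hC, hev⟩ := exists_average_domination hT hρ hρ' hs hs' hgen
    (show 0 < ε / 4 * (ε / 2) by positivity)
  have hδ : 0 < min (ε / 4 / (C + 1)) (ε / 2) := lt_min (by positivity) (by positivity)
  refine ⟨min (ε / 4 / (C + 1)) (ε / 2), hδ, ?_⟩
  filter_upwards [hev] with n ⟨w, hw, hwint, hwε, hle⟩
  refine epsEntropy_le_of_imp fun k hk =>
    HasPartition.of_le hε hδ hC ?_ (min_le_right _ _) hw hwint hwε hle hk
  calc C * min (ε / 4 / (C + 1)) (ε / 2) ≤ (C + 1) * (ε / 4 / (C + 1)) := by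
        gcongr
        · linarith
        · exact min_le_left _ _
    _ = ε / 4 := by field_simp

theorem scalingSequences_subset {X : Type*} [MeasurableSpace X] [StandardBorelSpace X]
    {μ : Measure X} [IsProbabilityMeasure μ] {T : X ≃ᵐ X} (hT : MeasurePreserving T μ μ)
    {ρ ρ' : X → X → ℝ} (hρ : IsAdmissible μ ρ) (hρ' : IsAdmissible μ ρ')
    (hs : IsSummable μ ρ) (hs' : IsSummable μ ρ') (hgen : IsGenerating μ T ρ)
    (hgen' : IsGenerating μ T ρ') :
    scalingSequences μ T ρ ⊆ scalingSequences μ T ρ' := by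
  rintro h ⟨hpos, hsup, ε₀, hε₀, hinf⟩
  refine ⟨hpos, fun ε hε => ?_, ?_⟩
  · obtain ⟨δ, hδ, hev⟩ := exists_eventually_epsEntropy_le hT hρ hρ' hs hs' hgen hε
    refine lt_of_le_of_lt (limsup_le_limsup ?_) (hsup δ hδ)
    filter_upwards [hev] with n hn
    exact ENNReal.div_le_div_right hn _
  -- The roles are reversed here. One comparison at level `ε₀ / 2` suffices, because entropy only
  -- grows as `ε` decreases below `δ`.
  · obtain ⟨δ, hδ, hev⟩ :=
      exists_eventually_epsEntropy_le hT hρ' hρ hs' hs hgen' (half_pos hε₀)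
    refine ⟨δ, hδ, fun ε _ hεδ => ?_⟩
    refine lt_of_lt_of_le (hinf (ε₀ / 2) (half_pos hε₀) (half_lt_self hε₀)) (liminf_le_liminf ?_)
    filter_upwards [hev] with n hn
    exact ENNReal.div_le_div_right (hn.trans (epsEntropy_anti hεδ.le)) _

end ScalingEntropy

theorem theorem1 {X : Type*} [MeasurableSpace X] [StandardBorelSpace X]
    (μ : MeasureTheory.Measure X) [MeasureTheory.IsProbabilityMeasure μ]
    (T : X ≃ᵐ X) (hT : Ergodic T μ)
    (ρ ρ' : X → X → ℝ)
    (hρ : ScalingEntropy.IsAdmissible μ ρ) (hρ' : ScalingEntropy.IsAdmissible μ ρ')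
    (hρ_sum : ScalingEntropy.IsSummable μ ρ) (hρ'_sum : ScalingEntropy.IsSummable μ ρ')
    (hρ_gen : ScalingEntropy.IsGenerating μ T ρ)
    (hρ'_gen : ScalingEntropy.IsGenerating μ T ρ') :
    ScalingEntropy.scalingSequences μ T ρ = ScalingEntropy.scalingSequences μ T ρ' := by
  have hT' := hT.toMeasurePreserving
  exact Set.Subset.antisymm
    (ScalingEntropy.scalingSequences_subset hT' hρ hρ' hρ_sum hρ'_sum hρ_gen hρ'_gen)
    (ScalingEntropy.scalingSequences_subset hT' hρ' hρ hρ'_sum hρ_sum hρ'_gen hρ_gen)
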